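/- Consider $N$ transmitter–receiver pairs sharing $u\ge 1$ orthogonal sub-bands, with real, static channel gains $h_{k,i}\neq 0$ from transmitter $k$ to receiver $i$. In every slot user $i$, independently of the other users, picks a number $v\in\{0,\dots,u\}$ with probability $\mu_{i,v}$ (where $\sum_{v=0}^u\mu_{i,v}=1$), then a uniformly distributed set $S_i$ of $v$ sub-bands. It sends independent centred Gaussian signals of variance $P/v$ on these sub-bands and nothing on the others. Receiver $i$ observes the vector $\vec Y_i=h_{i,i}\vec X_i+\vec Z_i$ with $\vec Z_i=\sum_{k\ne i}h_{k,i}\vec X_k+\vec\nu_i$, where $\vec\nu_i$ is an independent Gaussian vector with i.i.d. $\mathcal N(0,\sigma^2)$ components. The achievable rate of user $i$ is $\mathscr R_i=\mathrm I(\vec X_i;\vec Y_i\mid S_i)=\sum_s\Pr(S_i=s)\,\mathrm I(\vec X_i;\vec Y_i\mid S_i=s)$. Let $\gamma=P/\sigma^2$ and let $\bar v_i=\sum_{v=0}^u v\,\mu_{i,v}\in[0,u]$ be the mean number of sub-bands used by user $i$. With $\mu$, $h$, $u$, $N$ fixed, and with $P,\sigma^2>0$ depending on $\gamma$ in any way such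 that $P/\sigma^2=\gamma$, each $\mathscr R_i$ is finite and $$\lim_{\gamma\to\infty}\frac{\mathscr R_i}{\log\gamma}=\frac12\,\bar v_i\prod_{k\ne i}\Bigl(1-\frac{\bar v_k}{u}\Bigr)\quad(1\le i\le N).$$ In particular, if $\bar v_i>0$ and $\bar v_k<u$ for all $k\neq i$, then $$\mathscr R_i\sim\frac12\,\bar v_i\prod_{k\ne i}\Bigl(1-\frac{\bar v_k}{u}\Bigr)\log\gamma ,$$ where $f(\gamma)\sim g(\gamma)$ means $\lim_{\gamma\to\infty}f(\gamma)/g(\gamma)=1$. Hence, with $\mathsf{SMG}(\bar v_1,\dots,\bar v_N)=\sum_{i=1}^N\frac12\,\bar v_i\prod_{k\ne i}(1-\bar v_k/u)$, $$\lim_{\gamma\to\infty}\frac{\sum_{i=1}^N\mathscr R_i}{\log\gamma}=\mathsf{SMG}(\bar v_1,\dots,\bar v_N),$$ and $\sum_{i=1}^N\mathscr R_i\sim\mathsf{SMG}(\bar v_1,\dots,\bar v_N)\log\gamma$ whenever $\mathsf{SMG}(\bar v_1,\dots,\bar v_N)\neq0$. -/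

import Mathlib

open Filter Topology MeasureTheory ProbabilityTheory
open scoped ENNReal NNReal

noncomputable section

namespace FreqHop

/-- Mutual information (in nats) of a pair of random variables with joint law `ρ`: the
Kullback-Leibler divergence from the product of the marginals to the joint law. -/
def mutualInfo {α β : Type*} [MeasurableSpace α] [MeasurableSpace β]
    (ρ : Measure (α × β)) : ℝ≥0∞ :=
  InformationTheory.klDiv ρ (ρ.fst.prod ρ.snd)

/-- The asymptotic relation `f(γ) ∼ g(γ)`: the ratio `f(γ) / g(γ)` tends to `1` as `γ → ∞`. -/
def AsympEq (f g : ℝ → ℝ) : Prop :=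
  Tendsto (fun γ => f γ / g γ) atTop (𝓝 1)

theorem powersetCard_fin_nonempty {u : ℕ} (v : Fin (u + 1)) :
    (Finset.powersetCard (v : ℕ) (Finset.univ : Finset (Fin u))).Nonempty := by
  rw [Finset.powersetCard_nonempty, Finset.card_univ, Fintype.card_fin]
  exact Nat.lt_succ_iff.mp v.isLt

/-- Law of the set of sub-bands occupied in one slot: the first random generator picks a
number `v ∈ {0, …, u}` with distribution `μ`, the second one picks a uniformly distributed set
of `v` out of the `u` sub-bands. -/
def hopLaw {u : ℕ} (μ : PMF (Fin (u + 1))) : PMF (Finset (Fin u)) :=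
  μ.bind fun v =>
    PMF.uniformOfFinset (Finset.powersetCard (v : ℕ) Finset.univ) (powersetCard_fin_nonempty v)

/-- The mean number `∑ v, v * μ v` of sub-bands occupied in one slot. -/
def meanBands {u : ℕ} (μ : PMF (Fin (u + 1))) : ℝ :=
  ∑ v : Fin (u + 1), (v : ℝ) * (μ v).toReal

/-- Law of the transmitted vector when the set `s` of sub-bands is occupied: independent centred
Gaussian components, of variance `P / |s|` on `s` and of variance `0` off `s`. -/
def signalLaw {u : ℕ} (P : ℝ) (s : Finset (Fin u)) : Measure (Fin u → ℝ) :=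
  Measure.pi fun j => gaussianReal 0 (if j ∈ s then (P / (s.card : ℝ)).toNNReal else 0)

/-- Law of the vector transmitted by a hopping user: the mixture of the laws `signalLaw P s`,
where `s` is distributed according to `hopLaw μ`. -/
def transmitLaw {u : ℕ} (μ : PMF (Fin (u + 1))) (P : ℝ) : Measure (Fin u → ℝ) :=
  ∑ s : Finset (Fin u), hopLaw μ s • signalLaw P s

/-- Law of the ambient noise vector: i.i.d. centred Gaussian components of variance `σ2`. -/
def noiseLaw (u : ℕ) (σ2 : ℝ) : Measure (Fin u → ℝ) :=
  Measure.pi fun _ => gaussianReal 0 σ2.toNNReal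

/-- Joint law of all transmitted vectors and of the ambient noise at receiver `i`, given that
user `i` occupies the set `s`. All users and the noise are independent. -/
def slotLaw {N u : ℕ} (μ : Fin N → PMF (Fin (u + 1))) (P σ2 : ℝ) (i : Fin N)
    (s : Finset (Fin u)) : Measure ((Fin N → Fin u → ℝ) × (Fin u → ℝ)) :=
  (Measure.pi fun k => if k = i then signalLaw P s else transmitLaw (μ k) P).prod (noiseLaw u σ2)

/-- Noise plus interference at receiver `i`; `h k i` is the gain from transmitter `k` to
receiver `i`. -/
def noisePlusInterference {N u : ℕ} (h : Fin N → Fin N → ℝ) (i : Fin N)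
    (ω : (Fin N → Fin u → ℝ) × (Fin u → ℝ)) : Fin u → ℝ :=
  fun j => ∑ k ∈ Finset.univ.erase i, h k i * ω.1 k j + ω.2 j

/-- Joint law of the vector `X` transmitted by user `i` and the vector `Y = h i i X + Z` received
by user `i`, given that user `i` occupies the set `s`. -/
def channelLaw {N u : ℕ} (h : Fin N → Fin N → ℝ) (μ : Fin N → PMF (Fin (u + 1))) (P σ2 : ℝ)
    (i : Fin N) (s : Finset (Fin u)) : Measure ((Fin u → ℝ) × (Fin u → ℝ)) :=
  (slotLaw μ P σ2 i s).map fun ω =>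
    (ω.1 i, fun j => h i i * ω.1 i j + noisePlusInterference h i ω j)

/-- Achievable rate of user `i`: the conditional mutual information
`I(X; Y | S) = ∑ s, Pr(S = s) I(X; Y | S = s)`, where `S` is the set occupied by user `i`. -/
def rate {N u : ℕ} (h : Fin N → Fin N → ℝ) (μ : Fin N → PMF (Fin (u + 1))) (P σ2 : ℝ)
    (i : Fin N) : ℝ≥0∞ :=
  ∑ s : Finset (Fin u), hopLaw (μ i) s * mutualInfo (channelLaw h μ P σ2 i s)

/-- `(1/2) v i ∏_{k ≠ i} (1 - v k / u)`. -/
def userGain {N : ℕ} (u : ℕ) (v : Fin N → ℝ) (i : Fin N) : ℝ :=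
  1 / 2 * v i * ∏ k ∈ Finset.univ.erase i, (1 - v k / (u : ℝ))

/-- The function `SMG(v 1, …, v N) = ∑ i, (1/2) v i ∏_{k ≠ i} (1 - v k / u)`. -/
def SMG {N : ℕ} (u : ℕ) (v : Fin N → ℝ) : ℝ :=
  ∑ i, userGain u v i

end FreqHop

end

namespace FreqHop

section Mixture

variable {α τ : Type*} [MeasurableSpace α] [Fintype τ]

/-- Integral of `f log f` for a finite mixture `f = ∑ t, w t * φ t` of probability densities. -/
theorem mixture_mul_log_bounds {m : Measure α} (w : τ → ℝ) (hw : ∀ t, 0 ≤ w t)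
    (hw1 : ∑ t, w t = 1) (φ : τ → α → ℝ) (hφ : ∀ t x, 0 < φ t x) (hφm : ∀ t, Measurable (φ t))
    (hφi : ∀ t, Integrable (φ t) m) (hφ1 : ∀ t, ∫ x, φ t x ∂m = 1)
    (hφl : ∀ t, Integrable (fun x => φ t x * Real.log (φ t x)) m) :
    Integrable (fun x => (∑ t, w t * φ t x) * Real.log (∑ t, w t * φ t x)) m ∧
    ∑ t, w t * ∫ x, φ t x * Real.log (φ t x) ∂m + ∑ t, w t * Real.log (w t) ≤
      ∫ x, (∑ t, w t * φ t x) * Real.log (∑ t, w t * φ t x) ∂m ∧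
    ∫ x, (∑ t, w t * φ t x) * Real.log (∑ t, w t * φ t x) ∂m ≤
      ∑ t, w t * ∫ x, φ t x * Real.log (φ t x) ∂m := by
  have hup : ∀ x, (∑ t, w t * φ t x) * Real.log (∑ t, w t * φ t x) ≤
      ∑ t, w t * (φ t x * Real.log (φ t x)) := fun x => by
    have := Real.convexOn_mul_log.map_sum_le (t := Finset.univ) (w := w) (p := fun t => φ t x)
      (fun t _ => hw t) hw1 (fun t _ => (hφ t x).le)
    simpa using this
  have hlo : ∀ x, ∑ t, (w t * (φ t x * Real.log (φ t x)) + w t * Real.log (w t) * φ t x) ≤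
      (∑ t, w t * φ t x) * Real.log (∑ t, w t * φ t x) := fun x => by
    rw [Finset.sum_mul]
    refine Finset.sum_le_sum fun t _ => ?_
    rcases (hw t).eq_or_lt with h0 | h0
    · simp [← h0]
    · have h1 : w t * φ t x ≤ ∑ t, w t * φ t x :=
        Finset.single_le_sum (f := fun t => w t * φ t x)
          (fun t _ => mul_nonneg (hw t) (hφ t x).le) (Finset.mem_univ t)
      have h2 := Real.log_le_log (mul_pos h0 (hφ t x)) h1
      rw [Real.log_mul h0.ne' (hφ t x).ne'] at h2
      have h3 := mul_le_mul_of_nonneg_left h2 (mul_pos h0 (hφ t x)).le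
      linarith
  have iup : Integrable (fun x => ∑ t, w t * (φ t x * Real.log (φ t x))) m :=
    integrable_finsetSum _ fun t _ => (hφl t).const_mul _
  have ilo : Integrable (fun x => ∑ t, (w t * (φ t x * Real.log (φ t x)) +
      w t * Real.log (w t) * φ t x)) m :=
    integrable_finsetSum _ fun t _ => ((hφl t).const_mul _).add ((hφi t).const_mul _)
  have hmeas : Measurable fun x => (∑ t, w t * φ t x) * Real.log (∑ t, w t * φ t x) := by
    have : Measurable fun x => ∑ t, w t * φ t x :=
      Finset.measurable_sum _ fun t _ => (hφm t).const_mul _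
    exact this.mul this.log
  have hint := integrable_of_le_of_le hmeas.aestronglyMeasurable (ae_of_all _ hlo)
    (ae_of_all _ hup) ilo iup
  refine ⟨hint, ?_, ?_⟩
  · have := integral_mono ilo hint hlo
    rw [integral_finsetSum Finset.univ (f := fun t x => w t * (φ t x * Real.log (φ t x)) +
      w t * Real.log (w t) * φ t x)
      fun t _ => ((hφl t).const_mul _).add ((hφi t).const_mul _)] at this
    rw [← Finset.sum_add_distrib]
    refine le_trans (le_of_eq (Finset.sum_congr rfl fun t _ => ?_)) this
    rw [integral_add ((hφl t).const_mul _) ((hφi t).const_mul _), integral_const_mul,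
      integral_const_mul, hφ1, mul_one]
  · have := integral_mono hint iup hup
    rw [integral_finsetSum _ fun t _ => (hφl t).const_mul _] at this
    simpa only [integral_const_mul] using this

end Mixture

section KL

variable {α : Type*} [MeasurableSpace α]

/-- The Kullback-Leibler divergence of a probability measure with positive density `r`. -/
theorem klDiv_withDensity {ρ ν : Measure α} [IsProbabilityMeasure ρ] [IsProbabilityMeasure ν]
    (r : α → ℝ) (hr : ∀ x, 0 < r x) (hrm : Measurable r)
    (hρ : ρ = ν.withDensity fun x => ENNReal.ofReal (r x))
    (hi : Integrable (fun x => Real.log (r x)) ρ) :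
    InformationTheory.klDiv ρ ν ≠ ∞ ∧
      (InformationTheory.klDiv ρ ν).toReal = ∫ x, Real.log (r x) ∂ρ := by
  have hac : ρ ≪ ν := hρ ▸ withDensity_absolutelyContinuous _ _
  have h1 : ρ.rnDeriv ν =ᵐ[ν] fun x => ENNReal.ofReal (r x) := by
    conv_lhs => rw [hρ]
    exact Measure.rnDeriv_withDensity _ hrm.ennreal_ofReal
  have h2 : llr ρ ν =ᵐ[ρ] fun x => Real.log (r x) := by
    filter_upwards [hac.ae_le h1] with x hx
    rw [llr, hx, ENNReal.toReal_ofReal (hr x).le]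
  refine ⟨InformationTheory.klDiv_ne_top hac ((integrable_congr h2).2 hi), ?_⟩
  rw [InformationTheory.toReal_klDiv_of_measure_eq hac (by simp), integral_congr_ae h2]

/-- Mutual information of the input and the output of an additive-noise channel: the difference
of the differential entropies of the output and of the noise. -/
theorem mutualInfo_additive_noise {G : Type*} [AddCommGroup G] [MeasurableSpace G]
    [MeasurableAdd₂ G] [MeasurableSub₂ G] {m : Measure G} [SigmaFinite m]
    [m.IsAddRightInvariant]
    {PX PZ PY : Measure G} [IsProbabilityMeasure PX] [IsProbabilityMeasure PZ]
    [IsProbabilityMeasure PY] (A : G → G) (hA : Measurable A) (f g : G → ℝ)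
    (hf : ∀ x, 0 < f x) (hg : ∀ x, 0 < g x) (hfm : Measurable f) (hgm : Measurable g)
    (hPZ : PZ = m.withDensity fun x => ENNReal.ofReal (f x))
    (hPY : PY = m.withDensity fun x => ENNReal.ofReal (g x))
    (hY : (PX.prod PZ).map (fun p => A p.1 + p.2) = PY)
    (hfi : Integrable (fun x => Real.log (f x)) PZ)
    (hgi : Integrable (fun x => Real.log (g x)) PY) :
    mutualInfo ((PX.prod PZ).map fun p => (p.1, A p.1 + p.2)) ≠ ∞ ∧
    (mutualInfo ((PX.prod PZ).map fun p => (p.1, A p.1 + p.2))).toReal =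
      ∫ x, Real.log (f x) ∂PZ - ∫ x, Real.log (g x) ∂PY := by
  set T : G × G → G × G := fun p => (p.1, A p.1 + p.2) with hT
  have hTm : Measurable T := measurable_fst.prodMk ((hA.comp measurable_fst).add measurable_snd)
  set ρ := (PX.prod PZ).map T with hρ
  have : IsProbabilityMeasure ρ := Measure.isProbabilityMeasure_map hTm.aemeasurable
  have hfst : ρ.fst = PX := by
    rw [Measure.fst, hρ, Measure.map_map measurable_fst hTm]
    exact Measure.fst_prod
  have hsnd : ρ.snd = PY := by
    rw [Measure.snd, hρ, Measure.map_map measurable_snd hTm]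
    exact hY
  set r : G × G → ℝ := fun p => f (p.2 - A p.1) / g p.2 with hr
  have hrm : Measurable r :=
    (hfm.comp (measurable_snd.sub (hA.comp measurable_fst))).div (hgm.comp measurable_snd)
  have hdens : ρ = (PX.prod PY).withDensity fun p => ENNReal.ofReal (r p) := by
    refine Measure.ext_of_lintegral _ fun F hF => ?_
    rw [hρ, lintegral_map hF hTm, lintegral_prod (fun p => F (T p)) (hF.comp hTm).aemeasurable,
      lintegral_withDensity_eq_lintegral_mul _ hrm.ennreal_ofReal hF,
      lintegral_prod _ (hrm.ennreal_ofReal.mul hF).aemeasurable]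
    refine lintegral_congr fun x => ?_
    have hFx : Measurable fun z => F (x, z) := hF.comp measurable_prodMk_left
    have hrx : Measurable fun z => r (x, z) := hrm.comp measurable_prodMk_left
    have hTx : Measurable fun z => F (T (x, z)) := (hF.comp hTm).comp measurable_prodMk_left
    have hrF : Measurable fun z => ((fun p => ENNReal.ofReal (r p)) * F) (x, z) :=
      hrx.ennreal_ofReal.mul hFx
    rw [hPZ, hPY, lintegral_withDensity_eq_lintegral_mul _ hfm.ennreal_ofReal hTx,
      lintegral_withDensity_eq_lintegral_mul _ hgm.ennreal_ofReal hrF]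
    rw [← lintegral_sub_right_eq_self _ (A x)]
    refine lintegral_congr fun y => ?_
    simp only [Pi.mul_apply, hT, hr, add_sub_cancel]
    rw [← mul_assoc, ← ENNReal.ofReal_mul (hg y).le, mul_div_cancel₀ _ (hg y).ne']
  have hlog : ∀ p, Real.log (r p) = Real.log (f (p.2 - A p.1)) - Real.log (g p.2) :=
    fun p => Real.log_div (hf _).ne' (hg _).ne'
  have hfm' : Measurable fun p : G × G => Real.log (f (p.2 - A p.1)) :=
    (hfm.comp (measurable_snd.sub (hA.comp measurable_fst))).log
  have hgm' : Measurable fun p : G × G => Real.log (g p.2) := (hgm.comp measurable_snd).log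
  have hmpZ : MeasurePreserving (Prod.snd : G × G → G) (PX.prod PZ) PZ := measurePreserving_snd
  have hmpY : MeasurePreserving (Prod.snd : G × G → G) ρ PY := ⟨measurable_snd, hsnd⟩
  have e1 : (fun p : G × G => Real.log (f (p.2 - A p.1))) ∘ T =
      (fun z => Real.log (f z)) ∘ Prod.snd := by
    ext p; simp [hT]
  have i1 : Integrable (fun p : G × G => Real.log (f (p.2 - A p.1))) ρ := by
    rw [hρ, integrable_map_measure hfm'.aestronglyMeasurable hTm.aemeasurable, e1]
    exact hmpZ.integrable_comp_of_integrable hfi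
  have i2 : Integrable (fun p : G × G => Real.log (g p.2)) ρ :=
    hmpY.integrable_comp_of_integrable hgi
  have := klDiv_withDensity (ρ := ρ) (ν := PX.prod PY) r (fun p => div_pos (hf _) (hg _)) hrm hdens
    (by simp only [hlog]; exact i1.sub i2)
  rw [mutualInfo, hfst, hsnd]
  refine ⟨this.1, this.2.trans ?_⟩
  simp only [hlog]
  rw [integral_sub i1 i2]
  congr 1
  · rw [hρ, integral_map hTm.aemeasurable hfm'.aestronglyMeasurable]
    have := integral_map (μ := PX.prod PZ) (φ := Prod.snd) measurable_snd.aemeasurable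
      (f := fun z => Real.log (f z)) hfm.log.aestronglyMeasurable
    rw [hmpZ.map_eq] at this
    rw [this]
    simp [hT]
  · rw [← hsnd, Measure.snd, integral_map measurable_snd.aemeasurable
      hgm.log.aestronglyMeasurable]

end KL
section Gauss

variable {ι : Type*} [Fintype ι]

/-- Law of a vector of independent centred Gaussian components with variances `v`. -/
noncomputable def gaussPi (v : ι → ℝ≥0) : Measure (ι → ℝ) := Measure.pi fun j => gaussianReal 0 (v j)

instance (v : ι → ℝ≥0) : IsProbabilityMeasure (gaussPi v) := by
  unfold gaussPi; infer_instance

/-- Density of `gaussPi v`. -/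
noncomputable def gaussPiPDF (v : ι → ℝ≥0) (x : ι → ℝ) : ℝ := ∏ j, gaussianPDFReal 0 (v j) (x j)

theorem measurable_gaussPiPDF (v : ι → ℝ≥0) : Measurable (gaussPiPDF v) :=
  Finset.measurable_prod _ fun j _ => (measurable_gaussianPDFReal 0 (v j)).comp (measurable_pi_apply j)

theorem gaussPiPDF_pos {v : ι → ℝ≥0} (hv : ∀ j, v j ≠ 0) (x : ι → ℝ) : 0 < gaussPiPDF v x :=
  Finset.prod_pos fun j _ => gaussianPDFReal_pos 0 (v j) (x j) (hv j)

theorem gaussPi_eq_withDensity {v : ι → ℝ≥0} (hv : ∀ j, v j ≠ 0) :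
    gaussPi v = volume.withDensity fun x => ENNReal.ofReal (gaussPiPDF v x) := by
  refine Measure.pi_eq fun s hs => ?_
  rw [withDensity_apply _ (MeasurableSet.univ_pi hs), volume_pi, Measure.restrict_pi_pi]
  have hi : Integrable (gaussPiPDF v) (Measure.pi fun j => volume.restrict (s j)) :=
    Integrable.fintype_prod fun j => (integrable_gaussianPDFReal 0 (v j)).restrict
  rw [← ofReal_integral_eq_lintegral_ofReal hi (ae_of_all _ fun x => (gaussPiPDF_pos hv x).le)]
  simp only [gaussPiPDF]
  rw [integral_fintype_prod_eq_prod (fun j => gaussianPDFReal 0 (v j)),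
    ENNReal.ofReal_prod_of_nonneg fun j _ =>
      integral_nonneg fun x => gaussianPDFReal_nonneg _ _ _]
  exact Finset.prod_congr rfl fun j _ => (gaussianReal_apply_eq_integral 0 (hv j) (s j)).symm

theorem integrable_log_gaussianPDFReal (v : ℝ≥0) (hv : v ≠ 0) :
    Integrable (fun x => Real.log (gaussianPDFReal 0 v x)) (gaussianReal 0 v) ∧
    ∫ x, Real.log (gaussianPDFReal 0 v x) ∂(gaussianReal 0 v) =
      -(1 / 2 * Real.log (2 * Real.pi * v)) - 1 / 2 := by
  have hv' : (0 : ℝ) < v := by positivity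
  have e : ∀ x, Real.log (gaussianPDFReal 0 v x) =
      -(1 / 2 * Real.log (2 * Real.pi * v)) - (2 * (v : ℝ))⁻¹ * x ^ 2 := fun x => by
    rw [gaussianPDFReal, Real.log_mul (by positivity) (Real.exp_pos _).ne', Real.log_exp,
      Real.log_inv, Real.log_sqrt (by positivity)]
    field_simp
    ring
  have i2 : Integrable (fun x : ℝ => x ^ 2) (gaussianReal 0 v) := by
    have := (memLp_id_gaussianReal (μ := 0) (v := v) 2).integrable_sq
    simpa using this
  have m2 : ∫ x, x ^ 2 ∂(gaussianReal 0 v) = v := by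
    have := variance_fun_id_gaussianReal (μ := 0) (v := v)
    rw [variance_eq_integral (by fun_prop)] at this
    simpa using this
  simp only [e]
  refine ⟨(integrable_const _).sub (i2.const_mul _), ?_⟩
  rw [integral_sub (integrable_const _) (i2.const_mul _), integral_const_mul, m2]
  simp
  field_simp

theorem integral_log_gaussPiPDF {v : ι → ℝ≥0} (hv : ∀ j, v j ≠ 0) :
    Integrable (fun x => Real.log (gaussPiPDF v x)) (gaussPi v) ∧
    ∫ x, Real.log (gaussPiPDF v x) ∂(gaussPi v) =
      ∑ j, (-(1 / 2 * Real.log (2 * Real.pi * v j)) - 1 / 2) := by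
  have e : ∀ x, Real.log (gaussPiPDF v x) = ∑ j, Real.log (gaussianPDFReal 0 (v j) (x j)) :=
    fun x => Real.log_prod fun j _ => (gaussianPDFReal_pos 0 (v j) (x j) (hv j)).ne'
  have hi : ∀ j, Integrable (fun x : ι → ℝ => Real.log (gaussianPDFReal 0 (v j) (x j)))
      (gaussPi v) := fun j =>
    integrable_comp_eval (μ := fun j => gaussianReal 0 (v j)) (i := j)
      (integrable_log_gaussianPDFReal (v j) (hv j)).1
  simp only [e]
  refine ⟨integrable_finsetSum _ fun j _ => hi j, ?_⟩
  rw [integral_finsetSum _ fun j _ => hi j]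
  refine Finset.sum_congr rfl fun j _ => ?_
  rw [← (integrable_log_gaussianPDFReal (v j) (hv j)).2]
  exact integral_comp_eval (μ := fun j => gaussianReal 0 (v j))
    (integrable_log_gaussianPDFReal (v j) (hv j)).1.aestronglyMeasurable

theorem charFunDual_gaussPi [DecidableEq ι] (v : ι → ℝ≥0) (L : StrongDual ℝ (ι → ℝ)) :
    charFunDual (gaussPi v) L =
      Complex.exp (-((∑ j, (v j : ℝ) * L (Pi.single j 1) ^ 2 : ℝ) : ℂ) / 2) := by
  rw [gaussPi, charFunDual_pi]
  have : ∀ j, charFunDual (gaussianReal 0 (v j)) (L.comp (.single ℝ (fun _ : ι => ℝ) j)) =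
      Complex.exp (-(((v j : ℝ) * L (Pi.single j 1) ^ 2 : ℝ) : ℂ) / 2) := fun j => by
    rw [charFunDual_eq_charFun_map_one, gaussianReal_map_continuousLinearMap, charFun_gaussianReal]
    congr 1
    simp [max_eq_left (sq_nonneg (L (Pi.single j 1)))]
    ring
  simp only [this]
  rw [← Complex.exp_sum]
  congr 1
  push_cast
  rw [← Finset.sum_div, Finset.sum_neg_distrib]

end Gauss
section WithDensity

variable {α : Type*} [MeasurableSpace α] {m : Measure α} {f : α → ℝ}

theorem integrable_withDensity_ofReal_iff (hf : Measurable f) (hf0 : ∀ x, 0 ≤ f x) (g : α → ℝ) :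
    Integrable g (m.withDensity fun x => ENNReal.ofReal (f x)) ↔
      Integrable (fun x => f x * g x) m := by
  rw [integrable_withDensity_iff_integrable_smul' hf.ennreal_ofReal (by simp)]
  simp [ENNReal.toReal_ofReal (hf0 _)]

theorem integral_withDensity_ofReal (hf : Measurable f) (hf0 : ∀ x, 0 ≤ f x) (g : α → ℝ) :
    ∫ x, g x ∂(m.withDensity fun x => ENNReal.ofReal (f x)) = ∫ x, f x * g x ∂m := by
  rw [integral_withDensity_eq_integral_toReal_smul hf.ennreal_ofReal (by simp)]
  simp [ENNReal.toReal_ofReal (hf0 _)]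

end WithDensity

section Finite

variable {α β τ : Type*} [MeasurableSpace α] [MeasurableSpace β] [Fintype τ]

theorem map_sum_smul (w : τ → ℝ≥0) (μ : τ → Measure α) {f : α → β} (hf : Measurable f) :
    (∑ t, w t • μ t).map f = ∑ t, w t • (μ t).map f := by
  ext s hs
  simp [Measure.map_apply hf hs, Measure.finsetSum_apply]

theorem isProbabilityMeasure_sum_smul (w : τ → ℝ≥0) (hw : ∑ t, w t = 1) (μ : τ → Measure α)
    [∀ t, IsProbabilityMeasure (μ t)] : IsProbabilityMeasure (∑ t, w t • μ t) := by
  refine ⟨?_⟩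
  simp only [Measure.finsetSum_apply, Measure.smul_apply, measure_univ, ENNReal.smul_def,
    smul_eq_mul, mul_one]
  exact_mod_cast hw

theorem prod_sum_smul (w : τ → ℝ≥0) (μ : Measure α) [SFinite μ] (ν : τ → Measure β)
    [∀ t, IsProbabilityMeasure (ν t)] :
    μ.prod (∑ t, w t • ν t) = ∑ t, w t • μ.prod (ν t) := by
  ext s hs
  rw [Measure.prod_apply hs]
  simp only [Measure.finsetSum_apply, Measure.smul_apply, Measure.prod_apply hs]
  rw [lintegral_finsetSum]
  · refine Finset.sum_congr rfl fun t _ => ?_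
    simp only [ENNReal.smul_def, smul_eq_mul]
    rw [lintegral_const_mul _ (measurable_measure_prodMk_left hs)]
  · intro t _
    simp only [ENNReal.smul_def, smul_eq_mul]
    exact (measurable_measure_prodMk_left hs).const_mul _

theorem sum_smul_prod (w : τ → ℝ≥0) (μ : τ → Measure α) [∀ t, IsProbabilityMeasure (μ t)]
    (ν : Measure β) [SFinite ν] :
    (∑ t, w t • μ t).prod ν = ∑ t, w t • (μ t).prod ν := by
  ext s hs
  simp only [Measure.finsetSum_apply, Measure.smul_apply, Measure.prod_apply hs,
    lintegral_finsetSum_measure, lintegral_smul_measure]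

end Finite

section Gauss

variable {ι τ : Type*} [Fintype ι] [Fintype τ]

/-- Density of the mixture `∑ t, w t • gaussPi (v t)`. -/
noncomputable def mixPDF (w : τ → ℝ≥0) (v : τ → ι → ℝ≥0) (x : ι → ℝ) : ℝ :=
  ∑ t, (w t : ℝ) * gaussPiPDF (v t) x

theorem measurable_mixPDF (w : τ → ℝ≥0) (v : τ → ι → ℝ≥0) : Measurable (mixPDF w v) :=
  Finset.measurable_sum _ fun t _ => (measurable_gaussPiPDF (v t)).const_mul _

theorem mixPDF_pos {w : τ → ℝ≥0} (hw : ∑ t, w t = 1) {v : τ → ι → ℝ≥0} (hv : ∀ t j, v t j ≠ 0)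
    (x : ι → ℝ) : 0 < mixPDF w v x := by
  obtain ⟨t, -, ht⟩ := Finset.exists_ne_zero_of_sum_ne_zero (hw.trans_ne one_ne_zero)
  refine Finset.sum_pos' (fun t _ => mul_nonneg (w t).2 (gaussPiPDF_pos (hv t) x).le)
    ⟨t, Finset.mem_univ t, mul_pos ?_ (gaussPiPDF_pos (hv t) x)⟩
  exact_mod_cast pos_iff_ne_zero.2 ht

theorem mix_eq_withDensity (w : τ → ℝ≥0) {v : τ → ι → ℝ≥0} (hv : ∀ t j, v t j ≠ 0) :
    ∑ t, w t • gaussPi (v t) = volume.withDensity fun x => ENNReal.ofReal (mixPDF w v x) := by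
  have e : ∀ x, ENNReal.ofReal (mixPDF w v x) =
      ∑ t, (w t : ℝ≥0∞) * ENNReal.ofReal (gaussPiPDF (v t) x) := fun x => by
    rw [mixPDF, ENNReal.ofReal_sum_of_nonneg
      (f := fun t => (w t : ℝ) * gaussPiPDF (v t) x)
      fun t _ => mul_nonneg (w t).2 (gaussPiPDF_pos (hv t) x).le]
    refine Finset.sum_congr rfl fun t _ => ?_
    rw [ENNReal.ofReal_mul (w t).coe_nonneg, ENNReal.ofReal_coe_nnreal]
  ext s hs
  simp only [Measure.finsetSum_apply, Measure.smul_apply, gaussPi_eq_withDensity (hv _),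
    withDensity_apply _ hs, e]
  rw [lintegral_finsetSum _ fun t _ => (measurable_gaussPiPDF (v t)).ennreal_ofReal.const_mul _]
  refine Finset.sum_congr rfl fun t _ => ?_
  rw [lintegral_const_mul _ (measurable_gaussPiPDF (v t)).ennreal_ofReal, ENNReal.smul_def,
    smul_eq_mul]

/-- The differential entropy of a Gaussian mixture exceeds the mean of the differential
entropies of its components by at most the entropy of the weights. -/
theorem integral_log_mixPDF {w : τ → ℝ≥0} (hw : ∑ t, w t = 1) {v : τ → ι → ℝ≥0}
    (hv : ∀ t j, v t j ≠ 0) :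
    Integrable (fun x => Real.log (mixPDF w v x)) (∑ t, w t • gaussPi (v t)) ∧
    ∑ t, w t * ∑ j, (-(1 / 2 * Real.log (2 * Real.pi * v t j)) - 1 / 2) +
        ∑ t, w t * Real.log (w t) ≤
      ∫ x, Real.log (mixPDF w v x) ∂(∑ t, w t • gaussPi (v t)) ∧
    ∫ x, Real.log (mixPDF w v x) ∂(∑ t, w t • gaussPi (v t)) ≤
      ∑ t, w t * ∑ j, (-(1 / 2 * Real.log (2 * Real.pi * v t j)) - 1 / 2) := by
  have hg := fun t => integral_log_gaussPiPDF (hv t)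
  have hpos := fun t => gaussPiPDF_pos (hv t)
  have hm := fun t => measurable_gaussPiPDF (v t)
  have h1 : ∀ t, Integrable (gaussPiPDF (v t)) volume ∧ ∫ x, gaussPiPDF (v t) x = 1 := fun t => by
    have a := integrable_withDensity_ofReal_iff (m := volume) (hm t) (fun x => (hpos t x).le) 1
    have b := integral_withDensity_ofReal (m := volume) (hm t) (fun x => (hpos t x).le) 1
    rw [← gaussPi_eq_withDensity (hv t)] at a b
    simp only [Pi.one_apply, mul_one] at a b
    exact ⟨a.1 (integrable_const _), by rw [← b]; simp⟩
  have h2 : ∀ t, Integrable (fun x => gaussPiPDF (v t) x * Real.log (gaussPiPDF (v t) x)) volume ∧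
      ∫ x, gaussPiPDF (v t) x * Real.log (gaussPiPDF (v t) x) =
        ∑ j, (-(1 / 2 * Real.log (2 * Real.pi * v t j)) - 1 / 2) := fun t => by
    rw [← integrable_withDensity_ofReal_iff (hm t) (fun x => (hpos t x).le),
      ← integral_withDensity_ofReal (hm t) (fun x => (hpos t x).le),
      ← gaussPi_eq_withDensity (hv t)]
    exact hg t
  rw [mix_eq_withDensity w hv,
    integrable_withDensity_ofReal_iff (measurable_mixPDF w v) fun x => (mixPDF_pos hw hv x).le,
    integral_withDensity_ofReal (measurable_mixPDF w v) fun x => (mixPDF_pos hw hv x).le]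
  have := mixture_mul_log_bounds (m := volume) (fun t => (w t : ℝ)) (fun t => (w t).2)
    (by exact_mod_cast hw) (fun t => gaussPiPDF (v t)) hpos hm (fun t => (h1 t).1)
    (fun t => (h1 t).2) (fun t => (h2 t).1)
  simp only [(h2 _).2] at this
  exact this

theorem gaussPi_prod_map_add [DecidableEq ι] (q d : ι → ℝ≥0) (a : ℝ) :
    ((gaussPi q).prod (gaussPi d)).map (fun p => a • p.1 + p.2) =
      gaussPi fun j => d j + (a ^ 2).toNNReal * q j := by
  set A : ((ι → ℝ) × (ι → ℝ)) →L[ℝ] (ι → ℝ) :=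
    a • ContinuousLinearMap.fst ℝ _ _ + ContinuousLinearMap.snd ℝ _ _ with hA
  have hAm : Measurable (fun p : (ι → ℝ) × (ι → ℝ) => a • p.1 + p.2) := by fun_prop
  have e : (fun p : (ι → ℝ) × (ι → ℝ) => a • p.1 + p.2) = A := rfl
  have := Measure.isProbabilityMeasure_map (μ := (gaussPi q).prod (gaussPi d)) hAm.aemeasurable
  refine Measure.ext_of_charFunDual (funext fun L => ?_)
  rw [e, charFunDual_map, charFunDual_prod, charFunDual_gaussPi, charFunDual_gaussPi,
    charFunDual_gaussPi, ← Complex.exp_add]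
  congr 1
  rw [← add_div, ← neg_add, ← Complex.ofReal_add, ← Finset.sum_add_distrib]
  congr 3
  norm_cast
  refine Finset.sum_congr rfl fun j _ => ?_
  have h1 : A (Pi.single j 1, 0) = a • Pi.single j 1 := by simp [hA]
  have h2 : A (0, Pi.single j 1) = Pi.single j 1 := by simp [hA]
  simp only [ContinuousLinearMap.comp_apply, ContinuousLinearMap.inl_apply,
    ContinuousLinearMap.inr_apply, h1, h2, map_smul, smul_eq_mul]
  push_cast
  rw [Real.coe_toNNReal _ (sq_nonneg a)]
  ring

theorem gaussPi_channel {κ : Type*} [Fintype κ] [DecidableEq κ] [DecidableEq ι]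
    (q : κ → ι → ℝ≥0) (n : ι → ℝ≥0) (i : κ) (a : ℝ) (h : κ → ℝ) :
    ((Measure.pi fun k => gaussPi (q k)).prod (gaussPi n)).map
        (fun ω => (ω.1 i, a • ω.1 i + (∑ k ∈ Finset.univ.erase i, h k • ω.1 k + ω.2))) =
      ((gaussPi (q i)).prod (gaussPi fun j =>
        n j + ∑ k ∈ Finset.univ.erase i, (h k ^ 2).toNNReal * q k j)).map
        (fun p => (p.1, a • p.1 + p.2)) := by
  set A : ((ι → ℝ) × (ι → ℝ)) →L[ℝ] (ι → ℝ) × (ι → ℝ) :=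
    (ContinuousLinearMap.fst ℝ _ _).prod
      (a • ContinuousLinearMap.fst ℝ _ _ + ContinuousLinearMap.snd ℝ _ _) with hA
  set π : κ → ((κ → ι → ℝ) × (ι → ℝ)) →L[ℝ] (ι → ℝ) := fun k =>
    (ContinuousLinearMap.proj (R := ℝ) (φ := fun _ : κ => ι → ℝ) k).comp
      (ContinuousLinearMap.fst ℝ _ _) with hπ
  set B : ((κ → ι → ℝ) × (ι → ℝ)) →L[ℝ] (ι → ℝ) × (ι → ℝ) :=
    (π i).prod (a • π i + (∑ k ∈ Finset.univ.erase i, h k • π k +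
      ContinuousLinearMap.snd ℝ _ _)) with hB
  have eA : (fun p : (ι → ℝ) × (ι → ℝ) => (p.1, a • p.1 + p.2)) = A := rfl
  have eB : (fun ω : (κ → ι → ℝ) × (ι → ℝ) =>
      (ω.1 i, a • ω.1 i + (∑ k ∈ Finset.univ.erase i, h k • ω.1 k + ω.2))) = B := by
    ext ω : 1
    simp [hB, hπ]
  rw [eA, eB]
  have := Measure.isProbabilityMeasure_map (μ := (Measure.pi fun k => gaussPi (q k)).prod (gaussPi n))
    B.continuous.measurable.aemeasurable
  have := Measure.isProbabilityMeasure_map (μ := (gaussPi (q i)).prod (gaussPi fun j =>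
        n j + ∑ k ∈ Finset.univ.erase i, (h k ^ 2).toNNReal * q k j))
    A.continuous.measurable.aemeasurable
  refine Measure.ext_of_charFunDual (funext fun L => ?_)
  rw [charFunDual_map, charFunDual_map, charFunDual_prod, charFunDual_prod, charFunDual_pi]
  simp only [charFunDual_gaussPi]
  rw [← Complex.exp_sum, ← Complex.exp_add, ← Complex.exp_add]
  congr 1
  have hBi : ∀ x : ι → ℝ, B (Pi.single i x, 0) = A (x, 0) := fun x => by
    have : ∑ k ∈ Finset.univ.erase i, h k • (Pi.single i x : κ → ι → ℝ) k = 0 :=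
      Finset.sum_eq_zero fun k hk => by
        rw [Pi.single_eq_of_ne (Finset.ne_of_mem_erase hk), smul_zero]
    rw [← eB, ← eA]
    simp [this]
  have hBk : ∀ k ∈ Finset.univ.erase i, ∀ x : ι → ℝ,
      B (Pi.single k x, 0) = h k • A (0, x) := fun k hk x => by
    have h1 : ∑ l ∈ Finset.univ.erase i, h l • (Pi.single k x : κ → ι → ℝ) l = h k • x := by
      rw [Finset.sum_eq_single_of_mem k hk, Pi.single_eq_same]
      intro l _ hl
      rw [Pi.single_eq_of_ne hl, smul_zero]
    rw [← eB, ← eA]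
    simp [h1, Pi.single_eq_of_ne (Finset.ne_of_mem_erase hk).symm]
  have hB0 : ∀ x : ι → ℝ, B (0, x) = A (0, x) := fun x => by
    rw [← eB, ← eA]
    simp
  simp only [ContinuousLinearMap.comp_apply, ContinuousLinearMap.inl_apply,
    ContinuousLinearMap.inr_apply, ContinuousLinearMap.single_apply, hB0]
  rw [← Finset.add_sum_erase _ _ (Finset.mem_univ i)]
  simp only [hBi]
  rw [add_assoc]
  congr 1
  rw [← Finset.sum_div, ← add_div, Finset.sum_neg_distrib, ← neg_add]
  congr 2
  norm_cast
  rw [Finset.sum_comm, ← Finset.sum_add_distrib]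
  refine Finset.sum_congr rfl fun j _ => ?_
  push_cast
  rw [add_mul, Finset.sum_mul, add_comm]
  congr 1
  refine Finset.sum_congr rfl fun k hk => ?_
  rw [hBk k hk, map_smul, smul_eq_mul, Real.coe_toNNReal _ (sq_nonneg _)]
  ring

/-- The mutual information of a Gaussian input and its sum with Gaussian-mixture noise. -/
theorem mutualInfo_gaussMix [DecidableEq ι] {w : τ → ℝ≥0} (hw : ∑ t, w t = 1) (q : ι → ℝ≥0)
    {d : τ → ι → ℝ≥0} (hd : ∀ t j, d t j ≠ 0) (a : ℝ) :
    mutualInfo (((gaussPi q).prod (∑ t, w t • gaussPi (d t))).map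
        fun p => (p.1, a • p.1 + p.2)) ≠ ∞ ∧
    |(mutualInfo (((gaussPi q).prod (∑ t, w t • gaussPi (d t))).map
        fun p => (p.1, a • p.1 + p.2))).toReal -
      ∑ t, w t * ∑ j, 1 / 2 * (Real.log (d t j + a ^ 2 * q j) - Real.log (d t j))| ≤
      -∑ t, w t * Real.log (w t) := by
  set d' : τ → ι → ℝ≥0 := fun t j => d t j + (a ^ 2).toNNReal * q j with hd'
  have hd'0 : ∀ t j, d' t j ≠ 0 := fun t j h => hd t j (add_eq_zero.1 h).1
  have := isProbabilityMeasure_sum_smul w hw fun t => gaussPi (d t)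
  have := isProbabilityMeasure_sum_smul w hw fun t => gaussPi (d' t)
  have hY : ((gaussPi q).prod (∑ t, w t • gaussPi (d t))).map (fun p => a • p.1 + p.2) =
      ∑ t, w t • gaussPi (d' t) := by
    rw [prod_sum_smul, map_sum_smul _ _ (by fun_prop)]
    simp only [gaussPi_prod_map_add, hd']
  obtain ⟨i1, l1, u1⟩ := integral_log_mixPDF hw hd
  obtain ⟨i2, l2, u2⟩ := integral_log_mixPDF hw hd'0
  have key := mutualInfo_additive_noise (m := volume) (PX := gaussPi q) (fun x => a • x)
    (by fun_prop) (mixPDF w d) (mixPDF w d') (mixPDF_pos hw hd) (mixPDF_pos hw hd'0)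
    (measurable_mixPDF w d) (measurable_mixPDF w d') (mix_eq_withDensity w hd)
    (mix_eq_withDensity w hd'0) hY i1 i2
  refine ⟨key.1, ?_⟩
  rw [key.2]
  have hs : ∑ t, w t * ∑ j, 1 / 2 * (Real.log (d t j + a ^ 2 * q j) - Real.log (d t j)) =
      ∑ t, w t * ∑ j, (-(1 / 2 * Real.log (2 * Real.pi * d t j)) - 1 / 2) -
      ∑ t, w t * ∑ j, (-(1 / 2 * Real.log (2 * Real.pi * d' t j)) - 1 / 2) := by
    rw [← Finset.sum_sub_distrib]
    refine Finset.sum_congr rfl fun t _ => ?_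
    rw [← mul_sub, ← Finset.sum_sub_distrib]
    congr 1
    refine Finset.sum_congr rfl fun j _ => ?_
    have h1 : (d t j : ℝ) ≠ 0 := by exact_mod_cast hd t j
    have h2 : (d' t j : ℝ) ≠ 0 := by exact_mod_cast hd'0 t j
    have h3 : (d' t j : ℝ) = d t j + a ^ 2 * q j := by simp [hd', max_eq_left (sq_nonneg a)]
    rw [Real.log_mul (by positivity) h1, Real.log_mul (by positivity) h2, h3]
    ring
  rw [hs, abs_le]
  constructor <;> linarith

end Gauss
section HopLaw

variable {u : ℕ}

theorem sum_toReal_pmf {α : Type*} [Fintype α] (p : PMF α) : ∑ x, (p x).toReal = 1 := by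
  rw [← ENNReal.toReal_sum fun x _ => p.apply_ne_top x, ← tsum_fintype (L := .unconditional _),
    p.tsum_coe, ENNReal.toReal_one]

/-- The probability that a given sub-band is not occupied. -/
theorem sum_hopLaw_notMem (μ : PMF (Fin (u + 1))) (j : Fin u) :
    ∑ x, (hopLaw μ x).toReal * (if j ∈ x then 0 else 1) = 1 - meanBands μ / u := by
  have hu : (u : ℝ) ≠ 0 := by
    have := j.pos
    positivity
  have e : ∀ x, (hopLaw μ x).toReal = ∑ v : Fin (u + 1), (μ v).toReal *
      (if x ∈ Finset.powersetCard (v : ℕ) Finset.univ then ((u.choose v : ℕ) : ℝ)⁻¹ else 0) :=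
    fun x => by
      rw [hopLaw, PMF.bind_apply, tsum_fintype, ENNReal.toReal_sum]
      · refine Finset.sum_congr rfl fun v _ => ?_
        rw [ENNReal.toReal_mul, PMF.uniformOfFinset_apply]
        split_ifs <;> simp
      · intro v _
        exact ENNReal.mul_ne_top (μ.apply_ne_top v) (PMF.apply_ne_top _ _)
  simp only [e, Finset.sum_mul]
  rw [Finset.sum_comm]
  have hv : ∀ v : Fin (u + 1), ∑ x, (μ v).toReal *
      (if x ∈ Finset.powersetCard (v : ℕ) Finset.univ then ((u.choose v : ℕ) : ℝ)⁻¹ else 0) *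
      (if j ∈ x then 0 else 1) = (μ v).toReal * (1 - v / u) := fun v => by
    have h1 : ∀ x : Finset (Fin u),
        (if x ∈ Finset.powersetCard (v : ℕ) Finset.univ then ((u.choose v : ℕ) : ℝ)⁻¹ else 0) *
        (if j ∈ x then 0 else 1) =
        if x ∈ Finset.powersetCard (v : ℕ) (Finset.univ.erase j)
          then ((u.choose v : ℕ) : ℝ)⁻¹ else 0 := fun x => by
      simp only [Finset.mem_powersetCard, Finset.subset_erase, Finset.subset_univ, true_and]
      split_ifs <;> simp_all
    simp only [mul_assoc, h1]
    rw [← Finset.mul_sum, Finset.sum_ite_mem, Finset.univ_inter, Finset.sum_const,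
      Finset.card_powersetCard, Finset.card_erase_of_mem (Finset.mem_univ j), Finset.card_univ,
      Fintype.card_fin, nsmul_eq_mul]
    congr 1
    obtain ⟨m, rfl⟩ : ∃ m, u = m + 1 := ⟨u - 1, by have := j.pos; omega⟩
    have hle : (v : ℕ) ≤ m + 1 := Nat.lt_succ_iff.1 v.2
    have h2 := congrArg (Nat.cast (R := ℝ)) (Nat.choose_mul_succ_eq m v)
    rw [Nat.cast_mul, Nat.cast_mul, Nat.cast_sub hle] at h2
    have h3 : (((m + 1).choose v : ℕ) : ℝ) ≠ 0 := by
      exact_mod_cast (Nat.choose_pos hle).ne'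
    rw [Nat.add_sub_cancel]
    field_simp
    linarith
  rw [Finset.sum_congr rfl fun v _ => hv v]
  simp only [mul_sub, mul_one, Finset.sum_sub_distrib, sum_toReal_pmf]
  rw [meanBands, Finset.sum_div]
  congr 1
  exact Finset.sum_congr rfl fun v _ => by ring

theorem sum_hopLaw_mem (μ : PMF (Fin (u + 1))) (j : Fin u) :
    ∑ x, (hopLaw μ x).toReal * (if j ∈ x then 1 else 0) = meanBands μ / u := by
  have h : ∀ x, (hopLaw μ x).toReal * (if j ∈ x then 1 else 0) =
      (hopLaw μ x).toReal - (hopLaw μ x).toReal * (if j ∈ x then 0 else 1) := fun x => by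
    split_ifs <;> simp
  simp only [h, Finset.sum_sub_distrib, sum_toReal_pmf, sum_hopLaw_notMem]
  ring

end HopLaw

section Channel

variable {N u : ℕ}

/-- Variances of the signal sent when the set `s` of sub-bands is occupied. -/
noncomputable def bandVar (P : ℝ) (s : Finset (Fin u)) (j : Fin u) : ℝ≥0 :=
  if j ∈ s then (P / (s.card : ℝ)).toNNReal else 0

theorem signalLaw_eq (P : ℝ) (s : Finset (Fin u)) : signalLaw P s = gaussPi (bandVar P s) := rfl

theorem coe_bandVar {P : ℝ} (hP : 0 ≤ P) (s : Finset (Fin u)) (j : Fin u) :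
    (bandVar P s j : ℝ) = P * if j ∈ s then (s.card : ℝ)⁻¹ else 0 := by
  rw [bandVar]
  split_ifs
  · rw [Real.coe_toNNReal _ (by positivity), div_eq_mul_inv]
  · simp

/-- Distribution of the set occupied by user `k`, given that user `i` occupies `s`. -/
noncomputable def condWeight (μ : Fin N → PMF (Fin (u + 1))) (i : Fin N) (s : Finset (Fin u))
    (k : Fin N) (x : Finset (Fin u)) : ℝ≥0 :=
  if k = i then (if x = s then 1 else 0) else (hopLaw (μ k) x).toNNReal

theorem sum_condWeight (μ : Fin N → PMF (Fin (u + 1))) (i : Fin N) (s : Finset (Fin u))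
    (k : Fin N) : ∑ x, condWeight μ i s k x = 1 := by
  by_cases hk : k = i
  · simp [condWeight, hk]
  · have := sum_toReal_pmf (hopLaw (μ k))
    simp only [condWeight, hk, if_false]
    rw [← NNReal.coe_inj, NNReal.coe_sum]
    exact this

/-- Probability of the configuration `t` of occupied sets, given that user `i` occupies `s`. -/
noncomputable def configWeight (μ : Fin N → PMF (Fin (u + 1))) (i : Fin N) (s : Finset (Fin u))
    (t : Fin N → Finset (Fin u)) : ℝ≥0 :=
  ∏ k, condWeight μ i s k (t k)

theorem sum_prod_eq_prod_sum {κ τ R : Type*} [Fintype κ] [DecidableEq κ] [Fintype τ]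
    [CommSemiring R] (w : κ → τ → R) : ∑ t : κ → τ, ∏ k, w k (t k) = ∏ k, ∑ x, w k x := by
  rw [Finset.prod_univ_sum, Fintype.piFinset_univ]

theorem sum_configWeight (μ : Fin N → PMF (Fin (u + 1))) (i : Fin N) (s : Finset (Fin u)) :
    ∑ t, configWeight μ i s t = 1 := by
  simp only [configWeight]
  rw [sum_prod_eq_prod_sum]
  simp [sum_condWeight]

theorem configWeight_eq_zero (μ : Fin N → PMF (Fin (u + 1))) (i : Fin N) (s : Finset (Fin u))
    {t : Fin N → Finset (Fin u)} (ht : t i ≠ s) : configWeight μ i s t = 0 :=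
  Finset.prod_eq_zero (Finset.mem_univ i) (by simp [condWeight, ht])

theorem pi_sum_smul {κ τ α : Type*} [Fintype κ] [DecidableEq κ] [Fintype τ] [MeasurableSpace α]
    (w : κ → τ → ℝ≥0) (hw : ∀ k, ∑ x, w k x = 1) (ν : τ → Measure α)
    [∀ x, IsProbabilityMeasure (ν x)] :
    Measure.pi (fun k => ∑ x, w k x • ν x) =
      ∑ t : κ → τ, (∏ k, w k (t k)) • Measure.pi fun k => ν (t k) := by
  have := fun k => isProbabilityMeasure_sum_smul (w k) (hw k) ν
  refine Measure.pi_eq fun S hS => ?_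
  simp only [Measure.finsetSum_apply, Measure.smul_apply, Measure.pi_pi, ENNReal.smul_def,
    smul_eq_mul, ENNReal.ofNNReal_finsetProd, ← Finset.prod_mul_distrib]
  exact sum_prod_eq_prod_sum fun k x => (w k x : ℝ≥0∞) * ν x (S k)

/-- Variances of the noise plus interference when the sets `t k` are occupied. -/
noncomputable def noiseVar (h : Fin N → Fin N → ℝ) (P σ2 : ℝ) (i : Fin N)
    (t : Fin N → Finset (Fin u)) (j : Fin u) : ℝ≥0 :=
  σ2.toNNReal + ∑ k ∈ Finset.univ.erase i, (h k i ^ 2).toNNReal * bandVar P (t k) j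

theorem slotLaw_eq (μ : Fin N → PMF (Fin (u + 1))) (P σ2 : ℝ) (i : Fin N)
    (s : Finset (Fin u)) :
    slotLaw μ P σ2 i s = ∑ t, configWeight μ i s t •
      (Measure.pi fun k => gaussPi (bandVar P (t k))).prod (gaussPi fun _ => σ2.toNNReal) := by
  have h1 : (fun k => if k = i then signalLaw P s else transmitLaw (μ k) P) =
      fun k => ∑ x, condWeight μ i s k x • gaussPi (bandVar P x) := by
    funext k
    by_cases hk : k = i
    · simp [hk, condWeight, ite_smul, signalLaw_eq]
    · simp only [hk, if_false, condWeight, transmitLaw, signalLaw_eq]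
      refine Finset.sum_congr rfl fun x _ => ?_
      conv_lhs => rw [← ENNReal.coe_toNNReal (PMF.apply_ne_top (hopLaw (μ k)) x)]
      rfl
  have h2 : noiseLaw u σ2 = gaussPi fun _ => σ2.toNNReal := rfl
  rw [slotLaw, h1, h2, pi_sum_smul _ (sum_condWeight μ i s), sum_smul_prod]
  rfl

theorem channelLaw_eq (h : Fin N → Fin N → ℝ) (μ : Fin N → PMF (Fin (u + 1))) (P σ2 : ℝ)
    (i : Fin N) (s : Finset (Fin u)) :
    channelLaw h μ P σ2 i s =
      ((gaussPi (bandVar P s)).prod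
        (∑ t, configWeight μ i s t • gaussPi (noiseVar h P σ2 i t))).map
        fun p => (p.1, h i i • p.1 + p.2) := by
  have hF : (fun ω : (Fin N → Fin u → ℝ) × (Fin u → ℝ) =>
      (ω.1 i, fun j => h i i * ω.1 i j + noisePlusInterference h i ω j)) =
      fun ω => (ω.1 i, h i i • ω.1 i + (∑ k ∈ Finset.univ.erase i, h k i • ω.1 k + ω.2)) := by
    funext ω
    refine Prod.ext rfl (funext fun j => ?_)
    simp [noisePlusInterference]
  rw [channelLaw, hF, slotLaw_eq, map_sum_smul _ _ (by fun_prop), prod_sum_smul,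
    map_sum_smul _ _ (by fun_prop)]
  refine Finset.sum_congr rfl fun t _ => ?_
  by_cases ht : t i = s
  · rw [gaussPi_channel (fun k => bandVar P (t k)) (fun _ => σ2.toNNReal) i (h i i)
      (fun k => h k i), ht]
    rfl
  · rw [configWeight_eq_zero μ i s ht, zero_smul, zero_smul]

theorem mutualInfo_channelLaw (h : Fin N → Fin N → ℝ) (μ : Fin N → PMF (Fin (u + 1))) (P : ℝ)
    {σ2 : ℝ} (hσ : 0 < σ2) (i : Fin N) (s : Finset (Fin u)) :
    mutualInfo (channelLaw h μ P σ2 i s) ≠ ∞ ∧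
    |(mutualInfo (channelLaw h μ P σ2 i s)).toReal -
      ∑ t, configWeight μ i s t * ∑ j, 1 / 2 *
        (Real.log (noiseVar h P σ2 i t j + h i i ^ 2 * bandVar P s j) -
          Real.log (noiseVar h P σ2 i t j))| ≤
      -∑ t, configWeight μ i s t * Real.log (configWeight μ i s t) := by
  rw [channelLaw_eq]
  refine mutualInfo_gaussMix (sum_configWeight μ i s) _ (fun t j => ?_) _
  rw [noiseVar]
  have : 0 < σ2.toNNReal := Real.toNNReal_pos.2 hσ
  positivity

theorem rate_ne_top (h : Fin N → Fin N → ℝ) (μ : Fin N → PMF (Fin (u + 1))) (P : ℝ)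
    {σ2 : ℝ} (hσ : 0 < σ2) (i : Fin N) : rate h μ P σ2 i ≠ ∞ :=
  ENNReal.sum_ne_top.2 fun s _ => ENNReal.mul_ne_top (PMF.apply_ne_top _ _)
    (mutualInfo_channelLaw h μ P hσ i s).1

theorem toReal_rate (h : Fin N → Fin N → ℝ) (μ : Fin N → PMF (Fin (u + 1))) (P : ℝ)
    {σ2 : ℝ} (hσ : 0 < σ2) (i : Fin N) : (rate h μ P σ2 i).toReal =
      ∑ s, (hopLaw (μ i) s).toReal * (mutualInfo (channelLaw h μ P σ2 i s)).toReal := by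
  rw [rate, ENNReal.toReal_sum fun s _ => ENNReal.mul_ne_top (PMF.apply_ne_top _ _)
    (mutualInfo_channelLaw h μ P hσ i s).1]
  simp only [ENNReal.toReal_mul]

end Channel

section Limits

theorem tendsto_log_one_add_mul_div_log {c : ℝ} (hc : 0 ≤ c) :
    Tendsto (fun γ => Real.log (1 + γ * c) / Real.log γ) atTop (𝓝 (if 0 < c then 1 else 0)) := by
  rcases hc.eq_or_lt with rfl | hc
  · simp
  · rw [if_pos hc]
    have h1 : Tendsto (fun γ : ℝ => 1 + Real.log (γ⁻¹ + c) / Real.log γ) atTop (𝓝 (1 + 0)) := by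
      refine tendsto_const_nhds.add (Tendsto.div_atTop (a := Real.log (0 + c)) ?_
        Real.tendsto_log_atTop)
      exact ((tendsto_inv_atTop_zero.add_const c).log (by simpa using hc.ne'))
    rw [add_zero] at h1
    refine h1.congr' ?_
    filter_upwards [eventually_gt_atTop 1] with γ hγ
    have hl := Real.log_pos hγ
    have h0 : 0 < γ := by linarith
    have e : 1 + γ * c = γ * (γ⁻¹ + c) := by field_simp
    rw [e, Real.log_mul h0.ne' (by positivity)]
    field_simp

end Limits

section Rates

variable {N u : ℕ}

/-- Interference-to-power ratio in the sub-band `j` when the sets `t k` are occupied. -/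
noncomputable def interferenceRatio (h : Fin N → Fin N → ℝ) (i : Fin N)
    (t : Fin N → Finset (Fin u)) (j : Fin u) : ℝ :=
  ∑ k ∈ Finset.univ.erase i, h k i ^ 2 * if j ∈ t k then ((t k).card : ℝ)⁻¹ else 0

theorem interferenceRatio_nonneg (h : Fin N → Fin N → ℝ) (i : Fin N)
    (t : Fin N → Finset (Fin u)) (j : Fin u) : 0 ≤ interferenceRatio h i t j :=
  Finset.sum_nonneg fun k _ => mul_nonneg (sq_nonneg _) (by split_ifs <;> positivity)

theorem inv_card_pos {s : Finset (Fin u)} {j : Fin u} (hj : j ∈ s) : 0 < (s.card : ℝ)⁻¹ :=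
  inv_pos.2 (Nat.cast_pos.2 (Finset.card_pos.2 ⟨j, hj⟩))

theorem interferenceRatio_pos_iff {h : Fin N → Fin N → ℝ} (hh : ∀ k i, h k i ≠ 0) (i : Fin N)
    (t : Fin N → Finset (Fin u)) (j : Fin u) :
    0 < interferenceRatio h i t j ↔ ∃ k, k ≠ i ∧ j ∈ t k := by
  constructor
  · intro hp
    obtain ⟨k, hk, h0⟩ := Finset.exists_ne_zero_of_sum_ne_zero hp.ne'
    refine ⟨k, Finset.ne_of_mem_erase hk, ?_⟩
    by_contra hj
    simp [hj] at h0
  · rintro ⟨k, hk, hj⟩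
    refine Finset.sum_pos' (fun k _ => mul_nonneg (sq_nonneg _) (by split_ifs <;> positivity))
      ⟨k, Finset.mem_erase.2 ⟨hk, Finset.mem_univ k⟩, ?_⟩
    rw [if_pos hj]
    have := hh k i
    have := inv_card_pos hj
    positivity

theorem coe_noiseVar (h : Fin N → Fin N → ℝ) {σ2 γ : ℝ} (hσ : 0 < σ2) (hγ : 0 < γ) (i : Fin N)
    (t : Fin N → Finset (Fin u)) (j : Fin u) :
    (noiseVar h (γ * σ2) σ2 i t j : ℝ) = σ2 * (1 + γ * interferenceRatio h i t j) := by
  rw [noiseVar, interferenceRatio]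
  push_cast
  rw [Real.coe_toNNReal _ hσ.le, mul_add, mul_one, Finset.mul_sum, Finset.mul_sum]
  congr 1
  refine Finset.sum_congr rfl fun k _ => ?_
  rw [Real.coe_toNNReal _ (sq_nonneg _), coe_bandVar (by positivity)]
  ring

theorem tendsto_mutualInfo_div_log {h : Fin N → Fin N → ℝ} (hh : ∀ k i, h k i ≠ 0)
    (μ : Fin N → PMF (Fin (u + 1))) (P σ2 : ℝ → ℝ) (hσ : ∀ γ, 0 < γ → 0 < σ2 γ)
    (hP : ∀ γ, 0 < γ → P γ / σ2 γ = γ) (i : Fin N) (s : Finset (Fin u)) :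
    Tendsto (fun γ => (mutualInfo (channelLaw h μ (P γ) (σ2 γ) i s)).toReal / Real.log γ) atTop
      (𝓝 (∑ t, configWeight μ i s t * ∑ j, 1 / 2 *
        if j ∈ s ∧ ∀ k, k ≠ i → j ∉ t k then 1 else 0)) := by
  set M : ℝ → ℝ := fun γ => ∑ t, configWeight μ i s t * ∑ j, 1 / 2 *
    (Real.log (noiseVar h (P γ) (σ2 γ) i t j + h i i ^ 2 * bandVar (P γ) s j) -
      Real.log (noiseVar h (P γ) (σ2 γ) i t j)) with hM
  set b : Fin u → ℝ := fun j => h i i ^ 2 * if j ∈ s then (s.card : ℝ)⁻¹ else 0 with hb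
  have hb0 : ∀ j, 0 ≤ b j := fun j => mul_nonneg (sq_nonneg _) (by split_ifs <;> positivity)
  have hbpos : ∀ j, 0 < b j ↔ j ∈ s := fun j => by
    by_cases hj : j ∈ s
    · simp only [hb, hj, if_true, iff_true]
      have := hh i i
      have := inv_card_pos hj
      positivity
    · simp [hb, hj]
  have hc0 := interferenceRatio_nonneg (u := u) h i
  have hterm : ∀ t j, Tendsto (fun γ =>
      (Real.log (noiseVar h (P γ) (σ2 γ) i t j + h i i ^ 2 * bandVar (P γ) s j) -
        Real.log (noiseVar h (P γ) (σ2 γ) i t j)) / Real.log γ) atTop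
      (𝓝 (if j ∈ s ∧ ∀ k, k ≠ i → j ∉ t k then 1 else 0)) := fun t j => by
    have hlim := (tendsto_log_one_add_mul_div_log (add_nonneg (hc0 t j) (hb0 j))).sub
      (tendsto_log_one_add_mul_div_log (hc0 t j))
    have heq : ((if 0 < interferenceRatio h i t j + b j then 1 else 0) -
        (if 0 < interferenceRatio h i t j then 1 else 0) : ℝ) =
        if j ∈ s ∧ ∀ k, k ≠ i → j ∉ t k then 1 else 0 := by
      by_cases hc : 0 < interferenceRatio h i t j
      · obtain ⟨k, hk, hj⟩ := (interferenceRatio_pos_iff hh i t j).1 hc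
        rw [if_pos (add_pos_of_pos_of_nonneg hc (hb0 j)), if_pos hc, if_neg, sub_self]
        exact fun H => H.2 k hk hj
      · have hz : interferenceRatio h i t j = 0 := le_antisymm (not_lt.1 hc) (hc0 t j)
        have hn : ∀ k, k ≠ i → j ∉ t k := fun k hk hj =>
          hc ((interferenceRatio_pos_iff hh i t j).2 ⟨k, hk, hj⟩)
        rw [hz, zero_add, if_neg (lt_irrefl _), sub_zero]
        exact if_congr ((hbpos j).trans (and_iff_left hn).symm) rfl rfl
    rw [heq] at hlim
    refine hlim.congr' ?_
    filter_upwards [eventually_gt_atTop 0] with γ hγ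
    have hs := hσ γ hγ
    have hPγ : P γ = γ * σ2 γ := (div_eq_iff hs.ne').1 (hP γ hγ)
    have e1 := coe_noiseVar h hs hγ i t j
    have e2 : (noiseVar h (γ * σ2 γ) (σ2 γ) i t j : ℝ) + h i i ^ 2 * bandVar (γ * σ2 γ) s j =
        σ2 γ * (1 + γ * (interferenceRatio h i t j + b j)) := by
      rw [e1, coe_bandVar (by positivity), hb]
      ring
    have p1 : 0 < 1 + γ * interferenceRatio h i t j := by
      have := hc0 t j
      positivity
    have p2 : 0 < 1 + γ * (interferenceRatio h i t j + b j) := by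
      have := hc0 t j
      have := hb0 j
      positivity
    rw [hPγ, e2, e1, Real.log_mul hs.ne' p2.ne', Real.log_mul hs.ne' p1.ne', ← sub_div]
    congr 1
    ring
  have hMlim : Tendsto (fun γ => M γ / Real.log γ) atTop
      (𝓝 (∑ t, configWeight μ i s t * ∑ j, 1 / 2 *
        if j ∈ s ∧ ∀ k, k ≠ i → j ∉ t k then 1 else 0)) := by
    simp only [hM, Finset.sum_div, mul_div_assoc]
    exact tendsto_finsetSum _ fun t _ => (tendsto_finsetSum _ fun j _ =>
      (hterm t j).const_mul _).const_mul _
  have hdiff : Tendsto (fun γ => ((mutualInfo (channelLaw h μ (P γ) (σ2 γ) i s)).toReal - M γ) /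
      Real.log γ) atTop (𝓝 0) := by
    refine squeeze_zero_norm' (a := fun γ =>
      (-∑ t, configWeight μ i s t * Real.log (configWeight μ i s t)) / Real.log γ) ?_
      (tendsto_const_nhds.div_atTop Real.tendsto_log_atTop)
    filter_upwards [eventually_gt_atTop 1] with γ hγ
    have hl := Real.log_pos hγ
    rw [norm_div, Real.norm_eq_abs, Real.norm_of_nonneg hl.le]
    gcongr
    exact (mutualInfo_channelLaw h μ (P γ) (hσ γ (by linarith)) i s).2
  have := hMlim.add hdiff
  rw [add_zero] at this
  refine this.congr fun γ => ?_
  ring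

theorem sum_configWeight_free (μ : Fin N → PMF (Fin (u + 1))) (i : Fin N) (s : Finset (Fin u))
    (j : Fin u) :
    ∑ t, (configWeight μ i s t : ℝ) * (if ∀ k, k ≠ i → j ∉ t k then 1 else 0) =
      ∏ k ∈ Finset.univ.erase i, (1 - meanBands (μ k) / u) := by
  have h1 : ∀ t : Fin N → Finset (Fin u),
      (configWeight μ i s t : ℝ) * (if ∀ k, k ≠ i → j ∉ t k then 1 else 0) =
      ∏ k, (condWeight μ i s k (t k) : ℝ) * (if k = i then 1 else if j ∈ t k then 0 else 1) :=
    fun t => by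
      rw [Finset.prod_mul_distrib, configWeight, NNReal.coe_prod]
      congr 1
      split_ifs with hc
      · refine (Finset.prod_eq_one fun k _ => ?_).symm
        by_cases hk : k = i
        · simp [hk]
        · simp [hk, hc k hk]
      · push Not at hc
        obtain ⟨k, hk, hj⟩ := hc
        exact (Finset.prod_eq_zero (Finset.mem_univ k) (by simp [hk, hj])).symm
  simp only [h1]
  rw [sum_prod_eq_prod_sum fun k x => (condWeight μ i s k x : ℝ) *
    (if k = i then 1 else if j ∈ x then 0 else 1), ← Finset.mul_prod_erase _ _ (Finset.mem_univ i)]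
  have h2 : ∑ x, (condWeight μ i s i x : ℝ) * (if i = i then 1 else if j ∈ x then 0 else 1) = 1 := by
    have := sum_condWeight μ i s i
    simp only [if_true, mul_one]
    exact_mod_cast this
  rw [h2, one_mul]
  refine Finset.prod_congr rfl fun k hk => ?_
  rw [← sum_hopLaw_notMem (μ k) j]
  refine Finset.sum_congr rfl fun x _ => ?_
  rw [condWeight, if_neg (Finset.ne_of_mem_erase hk), if_neg (Finset.ne_of_mem_erase hk)]
  rfl

theorem tendsto_rate_div_log (hu : 0 < u) {h : Fin N → Fin N → ℝ} (hh : ∀ k i, h k i ≠ 0)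
    (μ : Fin N → PMF (Fin (u + 1))) (P σ2 : ℝ → ℝ) (hσ : ∀ γ, 0 < γ → 0 < σ2 γ)
    (hP : ∀ γ, 0 < γ → P γ / σ2 γ = γ) (i : Fin N) :
    Tendsto (fun γ => (rate h μ (P γ) (σ2 γ) i).toReal / Real.log γ) atTop
      (𝓝 (userGain u (fun k => meanBands (μ k)) i)) := by
  have hlim : Tendsto (fun γ => ∑ s, (hopLaw (μ i) s).toReal *
      ((mutualInfo (channelLaw h μ (P γ) (σ2 γ) i s)).toReal / Real.log γ)) atTop
      (𝓝 (∑ s, (hopLaw (μ i) s).toReal * ∑ t, (configWeight μ i s t : ℝ) * ∑ j, 1 / 2 *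
        if j ∈ s ∧ ∀ k, k ≠ i → j ∉ t k then 1 else 0)) :=
    tendsto_finsetSum _ fun s _ => (tendsto_mutualInfo_div_log hh μ P σ2 hσ hP i s).const_mul _
  have hin : ∀ s : Finset (Fin u), ∑ t, (configWeight μ i s t : ℝ) * ∑ j, 1 / 2 *
      (if j ∈ s ∧ ∀ k, k ≠ i → j ∉ t k then 1 else 0) =
      ∑ j, (if j ∈ s then 1 else 0) *
        (1 / 2 * ∏ k ∈ Finset.univ.erase i, (1 - meanBands (μ k) / u)) := fun s => by
    simp only [Finset.mul_sum]
    rw [Finset.sum_comm]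
    refine Finset.sum_congr rfl fun j _ => ?_
    rw [← sum_configWeight_free μ i s j, Finset.mul_sum, Finset.mul_sum]
    refine Finset.sum_congr rfl fun t _ => ?_
    by_cases h1 : j ∈ s <;> by_cases h2 : ∀ k, k ≠ i → j ∉ t k <;> simp [h1, h2, mul_comm]
  have hval : ∑ s, (hopLaw (μ i) s).toReal * ∑ t, (configWeight μ i s t : ℝ) * ∑ j, 1 / 2 *
      (if j ∈ s ∧ ∀ k, k ≠ i → j ∉ t k then 1 else 0) =
      userGain u (fun k => meanBands (μ k)) i := by
    rw [Finset.sum_congr rfl fun s _ => by rw [hin s, Finset.mul_sum], Finset.sum_comm]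
    simp only [← mul_assoc]
    rw [Finset.sum_congr rfl fun j _ => by
      rw [← Finset.sum_mul, ← Finset.sum_mul, sum_hopLaw_mem], Finset.sum_const, Finset.card_univ,
      Fintype.card_fin, userGain]
    have : (u : ℝ) ≠ 0 := by positivity
    rw [nsmul_eq_mul]
    field_simp
  rw [hval] at hlim
  refine hlim.congr' ?_
  filter_upwards [eventually_gt_atTop 0] with γ hγ
  rw [toReal_rate h μ (P γ) (hσ γ hγ) i, Finset.sum_div]
  simp only [mul_div_assoc]

theorem asympEq_mul_log {f : ℝ → ℝ} {c : ℝ} (hc : c ≠ 0)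
    (hf : Tendsto (fun γ => f γ / Real.log γ) atTop (𝓝 c)) :
    AsympEq f fun γ => c * Real.log γ := by
  have := hf.div_const c
  rw [div_self hc] at this
  refine this.congr fun γ => ?_
  rw [div_div, mul_comm]

end Rates
end FreqHop

theorem mainTheorem3 {N u : ℕ} (hu : 0 < u)
    (h : Fin N → Fin N → ℝ) (hh : ∀ k i, h k i ≠ 0)
    (μ : Fin N → PMF (Fin (u + 1)))
    (vbar : Fin N → ℝ) (hvbar : ∀ i, vbar i = FreqHop.meanBands (μ i))
    (P σ2 : ℝ → ℝ) (hσ : ∀ γ, 0 < γ → 0 < σ2 γ) (hP : ∀ γ, 0 < γ → P γ / σ2 γ = γ) :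
    (∀ i γ, 0 < γ → FreqHop.rate h μ (P γ) (σ2 γ) i ≠ ∞) ∧
    (∀ i, Tendsto (fun γ => (FreqHop.rate h μ (P γ) (σ2 γ) i).toReal / Real.log γ) atTop
      (𝓝 (FreqHop.userGain u vbar i))) ∧
    (∀ i, 0 < vbar i → (∀ k, k ≠ i → vbar k < (u : ℝ)) →
      FreqHop.AsympEq (fun γ => (FreqHop.rate h μ (P γ) (σ2 γ) i).toReal)
        (fun γ => FreqHop.userGain u vbar i * Real.log γ)) ∧
    Tendsto (fun γ => (∑ i, (FreqHop.rate h μ (P γ) (σ2 γ) i).toReal) / Real.log γ) atTop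
      (𝓝 (FreqHop.SMG u vbar)) ∧
    (FreqHop.SMG u vbar ≠ 0 →
      FreqHop.AsympEq (fun γ => ∑ i, (FreqHop.rate h μ (P γ) (σ2 γ) i).toReal)
        (fun γ => FreqHop.SMG u vbar * Real.log γ)) := by

  obtain rfl : vbar = fun k => FreqHop.meanBands (μ k) := funext hvbar
  have hlim := FreqHop.tendsto_rate_div_log hu hh μ P σ2 hσ hP
  have hsum : Tendsto (fun γ => (∑ i, (FreqHop.rate h μ (P γ) (σ2 γ) i).toReal) / Real.log γ) atTop
      (𝓝 (FreqHop.SMG u fun k => FreqHop.meanBands (μ k))) := by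
    simp only [Finset.sum_div]
    exact tendsto_finsetSum _ fun i _ => hlim i
  have hu' : (0 : ℝ) < u := Nat.cast_pos.2 hu
  refine ⟨fun i γ hγ => FreqHop.rate_ne_top h μ (P γ) (hσ γ hγ) i, hlim, fun i hi hk => ?_, hsum,
    fun h0 => FreqHop.asympEq_mul_log h0 hsum⟩
  refine FreqHop.asympEq_mul_log (ne_of_gt ?_) (hlim i)
  refine mul_pos (mul_pos one_half_pos hi) (Finset.prod_pos fun k hk' => ?_)
  rw [sub_pos, div_lt_one hu']
  exact hk k (Finset.ne_of_mem_erase hk')
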